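/- Let $\zeta$ be the Riemann zeta function. A set $T\subset\mathbb C$ is a \emph{cosum set} if $T=\{z_1+\overline{z_2}: z_1,z_2\in\Omega\}$ for some $\Omega\subset\mathbb C$. A function $f$ is \emph{co-positive definite} in $T$ if $\sum_{k,l=1}^n f(z_k+\overline{z_l})\,\xi_k\overline{\xi_l}\ge 0$ for all $n\in\mathbb N$, all $z_1,\dots,z_n\in\mathbb C$ with $z_k+\overline{z_l}\in T$ for all $k,l$, and all $\xi_1,\dots,\xi_n\in\mathbb C$; it is \emph{co-negative definite} in $T$ if $-f$ is co-positive definite in $T$. A non-negative Borel measure $\mu$ on $\mathbb R$ is \emph{exponentially finite} with respect to an interval $I$ if $\int_{\mathbb R} e^{-yt}\,d\mu(t)<\infty$ for all $y\in I$; its \emph{Fourier--Laplace transform} is $\mathcal{FL}(\mu)(z)=\int_{\mathbb R} e^{izt}\,d\mu(t)$. Then the following hold. (1) $\zeta$ is co-positive definite in the half-plane $\operatorname{Re} z>1$. (2) The measure $\mu=\sum_{n=1}^\infty\delta_{\ln n}$ is exponentially finite with respect to $(1,\infty)$, and $\zeta(z)=\mathcal{FL}(\mu)(iz)=\int_{\mathbb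 R} e^{-zt}\,d\mu(t)$, with an absolutely convergent integral, for all $z$ with $\operatorname{Re} z>1$. It is the only non-negative Borel measure on $\mathbb R$, exponentially finite with respect to $(1,\infty)$, with $\zeta(z)=\mathcal{FL}(\mu)(iz)$ for $\operatorname{Re} z>1$. Its distribution function is $H(t)=\sum_{n=1}^\infty h(t-\ln n)$, where $h(t)=0$ for $t<0$ and $h(t)=1$ for $t\ge0$; that is, the series converges for every $t\in\mathbb R$ and $\mu((a,b])=H(b)-H(a)$ for all real $a\le b$. (3) For every non-empty open cosum set $T\subset\{z\in\mathbb C:\operatorname{Re} z<1\}$, $\zeta$ is neither co-positive definite nor co-negative definite in $T$. -/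

import Mathlib

open MeasureTheory Set
open scoped ComplexOrder ComplexConjugate

noncomputable section

/-- `T ⊆ ℂ` is a cosum set: `T = Ω + conj Ω` for some `Ω ⊆ ℂ`. -/
def IsCosumSet (T : Set ℂ) : Prop :=
  ∃ Ω : Set ℂ, T = {z : ℂ | ∃ z₁ ∈ Ω, ∃ z₂ ∈ Ω, z = z₁ + conj z₂}

/-- `f` is co-positive definite in `T`: for all finite families `z` with `z k + conj (z l) ∈ T`
for all `k, l`, the matrix `[f (z k + conj (z l))]` is positive semidefinite. The inequality is in
the usual partial order of `ℂ`: the sum is real and nonnegative. -/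
def CoPositiveDefiniteOn (f : ℂ → ℂ) (T : Set ℂ) : Prop :=
  ∀ (n : ℕ) (z : Fin n → ℂ), (∀ k l, z k + conj (z l) ∈ T) →
    ∀ ξ : Fin n → ℂ, 0 ≤ ∑ k, ∑ l, f (z k + conj (z l)) * ξ k * conj (ξ l)

/-- `f` is co-negative definite in `T`: `-f` is co-positive definite in `T`. -/
def CoNegativeDefiniteOn (f : ℂ → ℂ) (T : Set ℂ) : Prop :=
  CoPositiveDefiniteOn (fun z => -f z) T

/-- A nonnegative Borel measure on `ℝ` is exponentially finite with respect to `I` if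
`∫ exp (-y t) dμ(t)` is finite for every `y ∈ I`. -/
def ExponentiallyFinite (μ : Measure ℝ) (I : Set ℝ) : Prop :=
  ∀ y ∈ I, ∫⁻ t, ENNReal.ofReal (Real.exp (-y * t)) ∂μ < ⊤

/-- The Fourier-Laplace transform `∫ exp (i z t) dμ(t)` of a measure on `ℝ`. -/
def fourierLaplace (μ : Measure ℝ) (z : ℂ) : ℂ :=
  ∫ t : ℝ, Complex.exp (Complex.I * z * t) ∂μ

/-- The measure `∑_{n ≥ 1} δ_{ln n}` on `ℝ`. -/
def logIntegerMeasure : Measure ℝ :=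
  Measure.sum fun n : ℕ => Measure.dirac (Real.log ((n : ℝ) + 1))

/-- The unit step function: `0` for `t < 0`, `1` for `t ≥ 0`. -/
def unitStep (t : ℝ) : ℝ := if t < 0 then 0 else 1

/-- `H t = ∑_{n ≥ 1} h (t - ln n)`, with `h` the unit step function. -/
def logIntegerCount (t : ℝ) : ℝ := ∑' n : ℕ, unitStep (t - Real.log ((n : ℝ) + 1))

end

/-! For `Re z > 1`, the Dirichlet series exhibits `ζ(z + conj w)` as a sum of rank-one kernels
`n^(-z) * conj (n^(-w))`, and the same series is the transform of `logIntegerMeasure`. Uniqueness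
reduces to that of characteristic functions, after weighting the measures by `exp (-y t)` to make
them finite.

Left of the pole the obstruction is the trivial zero at `-2`. An open cosum set contains a disc
about a real point `x`. Finite differences turn positivity on that disc into positivity of the
Hankel forms of the derivatives `f^(k+l)(x)` (`hankelPositive_of_coPositiveDefiniteOn`). This passes
to every real point of the half-plane, since `exp (s D)` is a limit of squares `(1 + s D / 2M)^(2M)`
(`HankelPositive.translate`, `HankelPositive.of_halfPlane`). At a real zero of `f` the corner entry
of the Hankel form vanishes, so all derivatives vanish (`HankelPositive.eq_zero`) and `f = 0` by the
identity theorem. But `ζ(0) ≠ 0`; the argument applies equally to `-ζ`. -/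

section

open Filter Topology Polynomial

/-! ### Polynomials as test vectors for Hankel forms -/

/-- The linear functional on real polynomials sending `X ^ n` to `u n`. -/
noncomputable def momentFunctional (u : ℕ → ℂ) : ℝ[X] →ₗ[ℝ] ℂ :=
  Polynomial.lsum fun n => LinearMap.toSpanSingleton ℝ ℂ (u n)

theorem momentFunctional_apply (u : ℕ → ℂ) (p : ℝ[X]) :
    momentFunctional u p = ∑ n ∈ p.support, (p.coeff n : ℂ) * u n := by
  simp [momentFunctional, Polynomial.sum]

theorem momentFunctional_monomial (u : ℕ → ℂ) (n : ℕ) (c : ℝ) :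
    momentFunctional u (monomial n c) = c * u n := by
  simp [momentFunctional, Polynomial.sum_monomial_index]

theorem momentFunctional_X_pow (u : ℕ → ℂ) (n : ℕ) :
    momentFunctional u (X ^ n) = u n := by
  rw [X_pow_eq_monomial, momentFunctional_monomial]; simp

theorem momentFunctional_C_mul (u : ℕ → ℂ) (c : ℝ) (p : ℝ[X]) :
    momentFunctional u (C c * p) = c * momentFunctional u p := by
  rw [C_mul', map_smul, Complex.real_smul]

/-- With `u` the derivatives of `f`, this is the composition rule for the operators `p(D)` and
`q(D)`. -/
theorem momentFunctional_mul (u : ℕ → ℂ) (p q : ℝ[X]) :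
    momentFunctional u (p * q) = momentFunctional (fun n => momentFunctional u (X ^ n * p)) q := by
  induction q using Polynomial.induction_on' with
  | add q r hq hr => rw [mul_add, map_add, map_add, hq, hr]
  | monomial n c =>
    rw [momentFunctional_monomial, ← C_mul_X_pow_eq_monomial, ← momentFunctional_C_mul]
    congr 1; ring

theorem momentFunctional_X_pow_mul (u : ℕ → ℂ) (n : ℕ) (p : ℝ[X]) :
    momentFunctional u (X ^ n * p) = ∑ k ∈ p.support, (p.coeff k : ℂ) * u (n + k) := by
  rw [momentFunctional_mul, momentFunctional_apply]
  refine Finset.sum_congr rfl fun k _ => ?_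
  rw [← pow_add, momentFunctional_X_pow, add_comm]

/-- The Hankel forms of the sequence `u` are positive semidefinite. -/
def HankelPositive (u : ℕ → ℂ) : Prop :=
  ∀ p : ℝ[X], 0 ≤ momentFunctional u (p * p)

theorem momentFunctional_X_sub_one_pow (u : ℕ → ℂ) (n : ℕ) :
    momentFunctional u ((X - 1) ^ n) =
      ∑ k ∈ Finset.range (n + 1), ((-1) ^ (n - k) * (n.choose k : ℂ)) * u k := by
  rw [sub_eq_add_neg, add_pow, map_sum]
  refine Finset.sum_congr rfl fun k _ => ?_
  have : (X ^ k * (-1) ^ (n - k) * (n.choose k : ℝ[X])) =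
      C ((-1) ^ (n - k) * (n.choose k : ℝ)) * X ^ k := by
    simp; ring
  rw [this, momentFunctional_C_mul, momentFunctional_X_pow]
  push_cast; ring

theorem sum_alternating_choose_mul_pow {m n : ℕ} (h : m ≤ n) :
    ∑ k ∈ Finset.range (n + 1), ((-1) ^ (n - k) * (n.choose k : ℂ)) * (k : ℂ) ^ m =
      if m = n then (n.factorial : ℂ) else 0 := by
  have := fwdDiff_iter_eq_sum_shift (1 : ℂ) (fun r : ℂ => r ^ m) n 0
  simp only [zero_add, nsmul_eq_mul, mul_one, zsmul_eq_mul] at this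
  push_cast at this
  rw [← this]
  split_ifs with hmn
  · subst hmn; rw [fwdDiff_iter_eq_factorial]; simp
  · rw [fwdDiff_iter_pow_eq_zero_of_lt (lt_of_le_of_ne h hmn)]; rfl

/-! ### From co-positive definiteness to derivatives -/

/-- Forward difference quotients of an analytic function converge to its derivatives. -/
theorem tendsto_difference_quotient {f : ℂ → ℂ} {x : ℂ} (hf : AnalyticAt ℂ f x) (n : ℕ) :
    Tendsto (fun h : ℝ => ((h : ℂ) ^ n)⁻¹ *
      ∑ k ∈ Finset.range (n + 1), ((-1) ^ (n - k) * (n.choose k : ℂ)) * f (x + k * h))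
      (𝓝[≠] 0) (𝓝 (iteratedDeriv n f x)) := by
  have hO := hf.hasFPowerSeriesAt.isBigO_sub_partialSum_pow (n + 1)
  set P := (FormalMultilinearSeries.ofScalars ℂ
    fun n => iteratedDeriv n f x / ↑n.factorial).partialSum (n + 1) with hP
  have hPs : ∀ y, P y = ∑ m ∈ Finset.range (n + 1),
      iteratedDeriv m f x / m.factorial * y ^ m := by
    intro y
    simp [hP, FormalMultilinearSeries.partialSum, FormalMultilinearSeries.ofScalars]
  -- The `n`-th difference kills the Taylor terms of degree below `n` and is exact on degree `n`.
  have hmain : ∀ h : ℝ, h ≠ 0 → ((h : ℂ) ^ n)⁻¹ * ∑ k ∈ Finset.range (n + 1),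
      ((-1) ^ (n - k) * (n.choose k : ℂ)) * P (k * h) = iteratedDeriv n f x := by
    intro h hh
    have hh' : (h : ℂ) ≠ 0 := by exact_mod_cast hh
    have : ∑ k ∈ Finset.range (n + 1), ((-1) ^ (n - k) * (n.choose k : ℂ)) * P (k * h) =
        ∑ m ∈ Finset.range (n + 1), iteratedDeriv m f x / m.factorial * h ^ m *
          ∑ k ∈ Finset.range (n + 1), ((-1) ^ (n - k) * (n.choose k : ℂ)) * (k : ℂ) ^ m := by
      simp_rw [hPs, Finset.mul_sum]
      rw [Finset.sum_comm]
      refine Finset.sum_congr rfl fun m _ => Finset.sum_congr rfl fun k _ => ?_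
      rw [mul_pow]; ring
    rw [this, Finset.sum_eq_single n]
    · rw [sum_alternating_choose_mul_pow le_rfl, if_pos rfl]
      have : (n.factorial : ℂ) ≠ 0 := by exact_mod_cast n.factorial_ne_zero
      field_simp
    · intro m hm hne
      rw [sum_alternating_choose_mul_pow (by simpa [Nat.lt_succ_iff] using hm), if_neg hne,
        mul_zero]
    · simp
  have hrem : ∀ k : ℕ, Tendsto (fun h : ℝ => ((h : ℂ) ^ n)⁻¹ * (f (x + k * h) - P (k * h)))
      (𝓝[≠] 0) (𝓝 0) := by
    intro k
    have ht : Tendsto (fun h : ℝ => (k : ℂ) * h) (𝓝 0) (𝓝 0) := by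
      have : Continuous (fun h : ℝ => (k : ℂ) * h) := by fun_prop
      simpa using this.tendsto 0
    have h1 : (fun h : ℝ => f (x + k * h) - P (k * h)) =O[𝓝[≠] 0] fun h : ℝ => h ^ (n + 1) := by
      refine ((hO.comp_tendsto ht).mono nhdsWithin_le_nhds).trans ?_
      refine Asymptotics.IsBigO.of_bound ((k : ℝ) ^ (n + 1)) (Eventually.of_forall fun h => ?_)
      simp [mul_pow]
    have h2 : (fun h : ℝ => ((h : ℂ) ^ n)⁻¹ * (f (x + k * h) - P (k * h))) =O[𝓝[≠] 0]
        fun h : ℝ => (h ^ n)⁻¹ * h ^ (n + 1) := by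
      refine Asymptotics.IsBigO.mul ?_ h1
      exact Asymptotics.IsBigO.of_bound 1 (Eventually.of_forall fun h => by simp)
    refine h2.trans_tendsto ?_
    refine Tendsto.congr' (f₁ := fun h : ℝ => h) ?_ (tendsto_id.mono_left nhdsWithin_le_nhds)
    filter_upwards [self_mem_nhdsWithin] with h hh
    have : h ≠ 0 := hh
    rw [pow_succ, inv_mul_cancel_left₀ (pow_ne_zero n this)]
  have hsum : Tendsto (fun h : ℝ => ∑ k ∈ Finset.range (n + 1),
      ((-1) ^ (n - k) * (n.choose k : ℂ)) *
        (((h : ℂ) ^ n)⁻¹ * (f (x + k * h) - P (k * h)))) (𝓝[≠] 0) (𝓝 0) := by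
    have := tendsto_finsetSum (Finset.range (n + 1)) fun k _ =>
      (hrem k).const_mul ((-1) ^ (n - k) * (n.choose k : ℂ))
    simpa using this
  have := hsum.add_const (iteratedDeriv n f x)
  rw [zero_add] at this
  refine this.congr' ?_
  filter_upwards [self_mem_nhdsWithin] with h hh
  rw [← hmain h hh, Finset.mul_sum, Finset.mul_sum, ← Finset.sum_add_distrib]
  refine Finset.sum_congr rfl fun k _ => ?_
  ring

/-- On the samples `f (x + k h)`, multiplication by `X` is the shift by `h`, so `(X - 1) / h` is a
difference quotient tending to `D`. Substitution respects products, hence keeps squares squares. -/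
theorem tendsto_momentFunctional_comp {f : ℂ → ℂ} {x : ℂ} (hf : AnalyticAt ℂ f x) (p : ℝ[X]) :
    Tendsto (fun h : ℝ => momentFunctional (fun k => f (x + k * h)) (p.comp (C h⁻¹ * (X - 1))))
      (𝓝[≠] 0) (𝓝 (momentFunctional (fun n => iteratedDeriv n f x) p)) := by
  induction p using Polynomial.induction_on' with
  | add p q hp hq => simpa only [add_comp, map_add] using hp.add hq
  | monomial n c =>
    rw [momentFunctional_monomial]
    refine ((tendsto_difference_quotient hf n).const_mul (c : ℂ)).congr fun h => ?_
    rw [monomial_comp, momentFunctional_C_mul, mul_pow, ← C_pow, momentFunctional_C_mul,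
      momentFunctional_X_sub_one_pow]
    push_cast
    rw [inv_pow]

theorem hankelPositive_of_coPositiveDefiniteOn {f : ℂ → ℂ} {x ε : ℝ} (hε : 0 < ε)
    (hf : AnalyticAt ℂ f x) (hpos : CoPositiveDefiniteOn f (Metric.ball (x : ℂ) ε)) :
    HankelPositive fun n => iteratedDeriv n f x := by
  intro p
  refine ge_of_tendsto (tendsto_momentFunctional_comp hf (p * p)) ?_
  set d := p.natDegree
  have hev : ∀ᶠ h : ℝ in 𝓝 0, (2 * d : ℝ) * |h| < ε := by
    have : Continuous fun h : ℝ => (2 * d : ℝ) * |h| := by fun_prop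
    exact this.tendsto 0 |>.eventually_lt_const (by simpa using hε)
  filter_upwards [nhdsWithin_le_nhds hev] with h hh
  rw [mul_comp]
  set q := p.comp (C h⁻¹ * (X - 1)) with hq
  have hdeg : q.natDegree ≤ d := by
    rw [hq]
    refine natDegree_comp_le.trans ?_
    have : (C h⁻¹ * (X - 1) : ℝ[X]).natDegree ≤ 1 := by
      refine (natDegree_C_mul_le _ _).trans ?_
      rw [← C_1, natDegree_X_sub_C]
    exact (Nat.mul_le_mul_left _ this).trans (by simp [d])
  -- Starting from `x / 2` makes the sums `x + (k + l) h`; they stay in the disc because `k + l ≤ 2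
  -- d`.
  have key := hpos (d + 1) (fun k => (x / 2 : ℝ) + (k : ℕ) * h) (by
    intro k l
    have hk : ((k : ℕ) : ℝ) ≤ d := by exact_mod_cast Nat.lt_succ_iff.mp k.2
    have hl : ((l : ℕ) : ℝ) ≤ d := by exact_mod_cast Nat.lt_succ_iff.mp l.2
    have e : ((x / 2 : ℝ) + ((k : ℕ) : ℂ) * h + conj (((x / 2 : ℝ) : ℂ) + ((l : ℕ) : ℂ) * h)) - x =
      (((k : ℕ) + (l : ℕ)) * h : ℝ) := by
        simp only [map_add, map_mul, Complex.conj_ofReal, Complex.conj_natCast]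
        push_cast; ring
    rw [mem_ball_iff_norm, e, Complex.norm_real, Real.norm_eq_abs, abs_mul]
    refine lt_of_le_of_lt (mul_le_mul_of_nonneg_right ?_ (abs_nonneg h)) hh
    rw [abs_of_nonneg (by positivity)]; linarith) (fun k => (q.coeff k : ℂ))
  refine key.trans_eq ?_
  have hqs : q = ∑ k : Fin (d + 1), C (q.coeff k) * X ^ (k : ℕ) := by
    rw [Fin.sum_univ_eq_sum_range (fun k => C (q.coeff k) * X ^ k)]
    exact as_sum_range_C_mul_X_pow' q (Nat.lt_succ_of_le hdeg)
  conv_rhs => rw [hqs, Finset.sum_mul_sum, map_sum]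
  refine Finset.sum_congr rfl fun k _ => ?_
  rw [map_sum]
  refine Finset.sum_congr rfl fun l _ => ?_
  have : C (q.coeff k) * X ^ (k : ℕ) * (C (q.coeff l) * X ^ (l : ℕ)) =
      C (q.coeff k * q.coeff l) * X ^ ((k : ℕ) + (l : ℕ)) := by
    rw [C_mul]; ring
  rw [this, momentFunctional_C_mul, momentFunctional_X_pow]
  have e : ((x / 2 : ℝ) + ((k : ℕ) : ℂ) * h + conj (((x / 2 : ℝ) : ℂ) + ((l : ℕ) : ℂ) * h)) =
      x + ((k : ℕ) + (l : ℕ) : ℕ) * h := by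
    simp only [map_add, map_mul, Complex.conj_ofReal, Complex.conj_natCast]
    push_cast; ring
  rw [e, Complex.conj_ofReal]
  push_cast; ring

/-! ### Propagation of positivity along the real line -/

/-- An analytic function with positive Hankel forms at `x` is nonnegative on the real diameter of
its disc of analyticity around `x`. -/
theorem HankelPositive.nonneg_add {g : ℂ → ℂ} {x R s : ℝ}
    (hg : DifferentiableOn ℂ g (Metric.ball (x : ℂ) R)) (hs : |s| < R)
    (hpos : HankelPositive fun n => iteratedDeriv n g x) : 0 ≤ g ((x + s : ℝ) : ℂ) := by
  set a : ℕ → ℂ := fun n => iteratedDeriv n g x with ha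
  have htaylor : ∀ w : ℝ, |w| < R →
      HasSum (fun n : ℕ => ((n.factorial : ℂ)⁻¹ * w ^ n) * a n) (g ((x + w : ℝ) : ℂ)) := by
    intro w hw
    have := Complex.hasSum_taylorSeries_on_ball hg (z := ((x + w : ℝ) : ℂ))
      (by simpa [mem_ball_iff_norm] using hw)
    simpa [ha, mul_assoc] using this
  have hsum := htaylor s hs
  -- These sums come from expanding `(1 + s X / M) ^ M` with `M = 2 (N + 1)`. The even exponent
  -- makes it a square, and its coefficients tend to those of `exp (s X)`.
  have hlim : Tendsto (fun N : ℕ => ∑' n : ℕ,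
      (((2 * (N + 1)).choose n : ℂ) * ((s / (2 * (N + 1) : ℕ) : ℝ) : ℂ) ^ n) * a n) atTop
      (𝓝 (∑' n : ℕ, ((n.factorial : ℂ)⁻¹ * s ^ n) * a n)) := by
    refine tendsto_tsum_of_dominated_convergence
      (bound := fun n => ‖((n.factorial : ℂ)⁻¹ * s ^ n) * a n‖) hsum.summable.norm ?_ ?_
    · intro n
      refine Tendsto.mul_const _ ?_
      have h1 := (isEquivalent_choose n)
      have h2 : Tendsto (fun M : ℕ => (M.choose n : ℝ) / (M : ℝ) ^ n) atTop
          (𝓝 ((n.factorial : ℝ)⁻¹)) := by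
        have h3 : Asymptotics.IsEquivalent atTop (fun M : ℕ => (M.choose n : ℝ) / (M : ℝ) ^ n)
            (fun M : ℕ => ((M : ℝ) ^ n / n.factorial) / (M : ℝ) ^ n) :=
          h1.div Asymptotics.IsEquivalent.refl
        have h4 : (fun M : ℕ => ((M : ℝ) ^ n / n.factorial) / (M : ℝ) ^ n) =ᶠ[atTop]
            fun _ => (n.factorial : ℝ)⁻¹ := by
          filter_upwards [eventually_gt_atTop 0] with M hM
          have : (M : ℝ) ≠ 0 := by positivity
          have : (n.factorial : ℝ) ≠ 0 := by positivity
          field_simp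
        exact (h3.congr_right h4).symm.tendsto_nhds tendsto_const_nhds
      have h5 : Tendsto (fun N : ℕ => 2 * (N + 1)) atTop atTop :=
        tendsto_atTop_mono (fun N => by simp only [id]; omega) tendsto_id
      have h6 := ((Complex.continuous_ofReal.tendsto _).comp (h2.comp h5)).mul_const ((s : ℂ) ^ n)
      have h7 : ((n.factorial : ℝ)⁻¹ : ℂ) = ((((n.factorial : ℝ)⁻¹ : ℝ)) : ℂ) := by push_cast; rfl
      convert h6 using 2
      · simp only [Function.comp]
        push_cast
        rw [div_pow]; ring
      · push_cast; rfl
    · refine Eventually.of_forall fun N n => ?_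
      rw [norm_mul _ (a n), norm_mul _ (a n)]
      refine mul_le_mul_of_nonneg_right ?_ (norm_nonneg _)
      -- Since `M.choose n ≤ M ^ n / n!`, the Taylor series at `s` itself dominates.
      have hc := Nat.choose_le_pow_div (α := ℝ) n (2 * (N + 1))
      have hM : (0 : ℝ) < ((2 * (N + 1) : ℕ) : ℝ) := by positivity
      rw [norm_mul, norm_mul, norm_inv, Complex.norm_natCast, norm_pow, norm_pow, Complex.norm_real,
        Complex.norm_natCast, Complex.norm_real, norm_div, Real.norm_natCast, div_pow]
      calc _ ≤ (((2 * (N + 1) : ℕ) : ℝ) ^ n / n.factorial) *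
            (‖s‖ ^ n / ((2 * (N + 1) : ℕ) : ℝ) ^ n) :=
            mul_le_mul_of_nonneg_right hc (by positivity)
        _ = _ := by field_simp
  rw [hsum.tsum_eq] at hlim
  refine ge_of_tendsto hlim (Eventually.of_forall fun N => ?_)
  set t : ℝ := s / (2 * (N + 1) : ℕ) with ht
  have := hpos ((C t * X + 1) ^ (N + 1))
  refine this.trans_eq ?_
  rw [← pow_add, ← two_mul, add_pow, map_sum,
    tsum_eq_sum (s := Finset.range (2 * (N + 1) + 1))]
  · refine Finset.sum_congr rfl fun n _ => ?_
    have : (C t * X) ^ n * 1 ^ (2 * (N + 1) - n) * ((2 * (N + 1)).choose n : ℝ[X]) =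
      C (((2 * (N + 1)).choose n : ℝ) * t ^ n) * X ^ n := by
        simp only [mul_pow, one_pow, map_mul, map_pow, map_natCast]; ring
    rw [this, momentFunctional_C_mul, momentFunctional_X_pow]
    push_cast; rfl
  · intro n hn
    rw [Nat.choose_eq_zero_of_lt (by simpa [Nat.lt_succ_iff] using hn)]
    simp

/-- Multiplication by `X` corresponds to differentiation of `p(D) f`. -/
theorem iteratedDeriv_momentFunctional {f : ℂ → ℂ} {U : Set ℂ} (hU : IsOpen U)
    (hf : DifferentiableOn ℂ f U) (p : ℝ[X]) (n : ℕ) {z : ℂ} (hz : z ∈ U) :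
    iteratedDeriv n (fun w => momentFunctional (fun k => iteratedDeriv k f w) p) z =
      momentFunctional (fun k => iteratedDeriv k f z) (X ^ n * p) := by
  have han : ∀ k, ContDiffAt ℂ n (iteratedDeriv k f) z := fun k => by
    have := (hf.analyticAt (hU.mem_nhds hz)).iterated_deriv k
    rw [← iteratedDeriv_eq_iterate] at this
    exact this.contDiffAt
  simp_rw [momentFunctional_X_pow_mul, momentFunctional_apply]
  rw [iteratedDeriv_fun_sum fun k _ => contDiffAt_const.mul (han k)]
  refine Finset.sum_congr rfl fun k _ => ?_
  rw [iteratedDeriv_const_mul _ (han k), iteratedDeriv_eq_iterate, iteratedDeriv_eq_iterate,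
    iteratedDeriv_eq_iterate, Function.iterate_add_apply]

/-- Apply `HankelPositive.nonneg_add` to `g = p(D)² f`: its Hankel form at `q` is that of `f` at `p
* q`. -/
theorem HankelPositive.translate {f : ℂ → ℂ} {x R s : ℝ}
    (hf : DifferentiableOn ℂ f (Metric.ball (x : ℂ) R)) (hs : |s| < R)
    (hpos : HankelPositive fun n => iteratedDeriv n f x) :
    HankelPositive fun n => iteratedDeriv n f ((x + s : ℝ) : ℂ) := by
  intro p
  have hx : (x : ℂ) ∈ Metric.ball (x : ℂ) R :=
    Metric.mem_ball_self ((abs_nonneg s).trans_lt hs)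
  refine HankelPositive.nonneg_add (R := R)
    (g := fun w => momentFunctional (fun k => iteratedDeriv k f w) (p * p)) ?_ hs ?_
  · simp_rw [momentFunctional_apply]
    refine DifferentiableOn.fun_sum fun k _ => DifferentiableOn.const_mul ?_ _
    intro z hz
    have := (hf.analyticAt (Metric.isOpen_ball.mem_nhds hz)).iterated_deriv k
    rw [← iteratedDeriv_eq_iterate] at this
    exact this.differentiableAt.differentiableWithinAt
  · intro q
    simp_rw [iteratedDeriv_momentFunctional Metric.isOpen_ball hf _ _ hx]
    rw [← momentFunctional_mul]
    have := hpos (p * q)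
    rwa [mul_mul_mul_comm] at this

/-- Testing on `t + X ^ n` leaves `2 t u n + u (2 n)`, with no quadratic term in `t`; an affine
function bounded below on the line is constant. -/
theorem HankelPositive.eq_zero {u : ℕ → ℂ} (hu : HankelPositive u) (h0 : u 0 = 0) (n : ℕ) :
    u n = 0 := by
  have key : ∀ t : ℝ, 0 ≤ (2 * t : ℂ) * u n + u (2 * n) := by
    intro t
    have := hu (C t + X ^ n)
    have e : (C t + X ^ n) * (C t + X ^ n) =
        C (t ^ 2) * X ^ 0 + C (2 * t) * X ^ n + C 1 * X ^ (2 * n) := by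
      simp only [map_pow, map_mul, map_one, pow_mul']
      rw [show (C 2 : ℝ[X]) = 2 from rfl]; ring
    rw [e, map_add, map_add, momentFunctional_C_mul, momentFunctional_C_mul,
      momentFunctional_C_mul, momentFunctional_X_pow, momentFunctional_X_pow,
      momentFunctional_X_pow, h0] at this
    simpa using this
  have k0 := Complex.nonneg_iff.mp (key 0)
  have k1 := Complex.nonneg_iff.mp (key 1)
  simp at k0 k1
  have him : (u n).im = 0 := by linarith [k0.2, k1.2]
  have hre : (u n).re = 0 := by
    by_contra hne
    -- This `t` makes the real part equal to `-1`.
    have k2 := (Complex.nonneg_iff.mp (key (-((u (2 * n)).re + 1) / (2 * (u n).re)))).1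
    have e : (2 * ((-((u (2 * n)).re + 1) / (2 * (u n).re) : ℝ) : ℂ)) =
      ((-((u (2 * n)).re + 1) / (u n).re : ℝ) : ℂ) := by
        push_cast
        have : ((u n).re : ℂ) ≠ 0 := by exact_mod_cast hne
        field_simp
    rw [e, Complex.add_re, Complex.re_ofReal_mul, div_mul_cancel₀ _ hne] at k2
    linarith
  exact Complex.ext hre him

/-- Positivity of the Hankel forms of an analytic function on a left half-plane spreads from one
real point to every real point of the half-plane further to the left. -/
theorem HankelPositive.of_halfPlane {f : ℂ → ℂ} {b : ℝ} (hf : DifferentiableOn ℂ f {z : ℂ | z.re < b})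
    {x : ℝ} (hx : x < b) (hpos : HankelPositive fun n => iteratedDeriv n f x) {y : ℝ}
    (hy : y < b) : HankelPositive fun n => iteratedDeriv n f y := by
  have step : ∀ {x y : ℝ}, |y - x| < b - x →
      (HankelPositive fun n => iteratedDeriv n f x) →
      HankelPositive fun n => iteratedDeriv n f y := by
    intro x y hxy h
    have hball : Metric.ball (x : ℂ) (b - x) ⊆ {z : ℂ | z.re < b} := by
      intro z hz
      rw [mem_ball_iff_norm] at hz
      have := (Complex.abs_re_le_norm (z - x)).trans_lt hz
      have := (abs_lt.mp this).2
      simp at this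
      exact this
    have := h.translate (hf.mono hball) hxy
    simpa using this
  -- Each step moves left by half the distance to `b`, inside the disc of analyticity, so that
  -- distance grows geometrically.
  have iter : ∀ n : ℕ, HankelPositive fun k =>
      iteratedDeriv k f ((b - (b - x) * (3 / 2) ^ n : ℝ) : ℂ) := by
    intro n
    induction n with
    | zero => simpa using hpos
    | succ n ih =>
      have hp : 0 < (b - x) * (3 / 2 : ℝ) ^ n := mul_pos (by linarith) (by positivity)
      refine step ?_ ih
      rw [pow_succ, abs_lt]
      constructor <;> nlinarith
  obtain ⟨n, hn⟩ := pow_unbounded_of_one_lt ((b - y) / (b - x)) (by norm_num : (1 : ℝ) < 3 / 2)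
  rw [div_lt_iff₀ (by linarith)] at hn
  refine step ?_ (iter n)
  rw [abs_lt]
  constructor <;> linarith

/-! ### Rigidity at a real zero -/

theorem eqOn_zero_of_coPositiveDefiniteOn_ball {f : ℂ → ℂ} {b x y ε : ℝ}
    (hf : DifferentiableOn ℂ f {z : ℂ | z.re < b}) (hx : x < b) (hε : 0 < ε)
    (hpos : CoPositiveDefiniteOn f (Metric.ball (x : ℂ) ε)) (hy : y < b) (h0 : f y = 0) :
    EqOn f 0 {z : ℂ | z.re < b} := by
  have hopen : IsOpen {z : ℂ | z.re < b} := isOpen_lt Complex.continuous_re continuous_const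
  have han := hf.analyticOnNhd hopen
  have hH := HankelPositive.of_halfPlane hf hx
    (hankelPositive_of_coPositiveDefiniteOn hε (han x (by simpa using hx)) hpos) hy
  have hder := hH.eq_zero (by simpa using h0)
  refine han.eqOn_zero_of_preconnected_of_eventuallyEq_zero
    (convex_halfSpace_re_lt b).isPreconnected (z₀ := (y : ℂ)) (by simpa using hy) ?_
  obtain ⟨r, hr, hball⟩ := Metric.isOpen_iff.mp hopen (y : ℂ) (by simpa using hy)
  filter_upwards [Metric.ball_mem_nhds _ hr] with z hz
  have := Complex.hasSum_taylorSeries_on_ball (hf.mono hball) hz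
  simp only [hder, smul_zero] at this
  exact this.unique hasSum_zero

theorem CoPositiveDefiniteOn.mono {f : ℂ → ℂ} {S T : Set ℂ} (h : CoPositiveDefiniteOn f T)
    (hST : S ⊆ T) : CoPositiveDefiniteOn f S :=
  fun n z hz ξ => h n z (fun k l => hST (hz k l)) ξ

/-- Take `z₁ = z₂ = z`: `z + conj z` is real. -/
theorem IsCosumSet.exists_ofReal_mem {T : Set ℂ} (hT : IsCosumSet T) (hne : T.Nonempty) :
    ∃ x : ℝ, (x : ℂ) ∈ T := by
  obtain ⟨Ω, rfl⟩ := hT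
  obtain ⟨_, z, hz, _, _, _⟩ := hne
  exact ⟨2 * z.re, z, hz, z, hz, by rw [Complex.add_conj]⟩

theorem not_coPositiveDefiniteOn_of_isCosumSet {f : ℂ → ℂ} {b y : ℝ} {T : Set ℂ}
    (hf : DifferentiableOn ℂ f {z : ℂ | z.re < b}) (hy : y < b) (h0 : f y = 0)
    (hne : ∃ z : ℂ, z.re < b ∧ f z ≠ 0) (hT : IsCosumSet T) (hopen : IsOpen T)
    (hnonempty : T.Nonempty) (hsub : T ⊆ {z : ℂ | z.re < b}) : ¬ CoPositiveDefiniteOn f T := by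
  intro hpos
  obtain ⟨x, hxT⟩ := hT.exists_ofReal_mem hnonempty
  obtain ⟨ε, hε, hball⟩ := Metric.isOpen_iff.mp hopen _ hxT
  obtain ⟨z, hz, hfz⟩ := hne
  exact hfz (eqOn_zero_of_coPositiveDefiniteOn_ball hf (by simpa using hsub hxT) hε
    (hpos.mono hball) hy h0 hz)

/-! ### The Dirichlet series as a Laplace transform -/

theorem exp_neg_mul_log_succ (z : ℂ) (n : ℕ) :
    Complex.exp (-z * (Real.log ((n : ℝ) + 1) : ℝ)) = 1 / ((n : ℂ) + 1) ^ z := by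
  have h : ((n : ℂ) + 1) ≠ 0 := Nat.cast_add_one_ne_zero n
  rw [Complex.cpow_def_of_ne_zero h, one_div, ← Complex.exp_neg, Complex.ofReal_log (by positivity)]
  push_cast
  congr 1; ring

theorem hasSum_riemannZeta_exp {z : ℂ} (hz : 1 < z.re) :
    HasSum (fun n : ℕ => Complex.exp (-z * (Real.log ((n : ℝ) + 1) : ℝ))) (riemannZeta z) := by
  simp_rw [exp_neg_mul_log_succ]
  rw [zeta_eq_tsum_one_div_nat_add_one_cpow hz]
  refine Summable.hasSum ?_
  have := (summable_nat_add_iff 1).mpr (Complex.summable_one_div_nat_cpow.mpr hz)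
  simpa using this

theorem coPositiveDefiniteOn_riemannZeta : CoPositiveDefiniteOn riemannZeta {z : ℂ | 1 < z.re} := by
  intro n z hz ξ
  have hsum : HasSum (fun m : ℕ => ∑ k, ∑ l,
      Complex.exp (-(z k + conj (z l)) * (Real.log ((m : ℝ) + 1) : ℝ)) * ξ k * conj (ξ l))
      (∑ k, ∑ l, riemannZeta (z k + conj (z l)) * ξ k * conj (ξ l)) :=
    hasSum_sum fun k _ => hasSum_sum fun l _ =>
      ((hasSum_riemannZeta_exp (hz k l)).mul_right _).mul_right _
  refine hsum.nonneg fun m => ?_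
  set L : ℝ := Real.log ((m : ℝ) + 1)
  have : ∑ k, ∑ l, Complex.exp (-(z k + conj (z l)) * L) * ξ k * conj (ξ l) =
      (∑ k, Complex.exp (-z k * L) * ξ k) * conj (∑ k, Complex.exp (-z k * L) * ξ k) := by
    rw [map_sum, Finset.sum_mul_sum]
    refine Finset.sum_congr rfl fun k _ => Finset.sum_congr rfl fun l _ => ?_
    rw [map_mul, ← Complex.exp_conj, map_mul, map_neg, Complex.conj_ofReal, neg_add, add_mul,
      Complex.exp_add]
    ring
  rw [this, Complex.mul_conj]
  exact_mod_cast Complex.normSq_nonneg _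

theorem I_mul_I_mul (z t : ℂ) : Complex.I * (Complex.I * z) * t = -z * t := by
  rw [← mul_assoc Complex.I, Complex.I_mul_I]; ring

theorem integrable_exp_logIntegerMeasure {z : ℂ} (hz : 1 < z.re) :
    Integrable (fun t : ℝ => Complex.exp (-z * t)) logIntegerMeasure := by
  refine integrable_sum_measure (fun n => integrable_dirac (by simp)) ?_
  simp_rw [integral_dirac]
  exact (hasSum_riemannZeta_exp hz).summable.norm

theorem riemannZeta_eq_fourierLaplace {z : ℂ} (hz : 1 < z.re) :
    riemannZeta z = fourierLaplace logIntegerMeasure (Complex.I * z) := by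
  simp_rw [fourierLaplace, I_mul_I_mul]
  have h := hasSum_integral_measure (μ := fun n : ℕ => Measure.dirac (Real.log ((n : ℝ) + 1)))
    (integrable_exp_logIntegerMeasure hz)
  simp_rw [integral_dirac] at h
  exact (hasSum_riemannZeta_exp hz).unique h

theorem exponentiallyFinite_logIntegerMeasure : ExponentiallyFinite logIntegerMeasure (Ioi 1) := by
  intro y hy
  have h := (integrable_exp_logIntegerMeasure (z := (y : ℂ)) (by simpa using hy)).hasFiniteIntegral
  refine (lintegral_congr fun t => ?_).trans_lt h
  rw [← ofReal_norm, Complex.norm_exp]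
  simp

/-! ### Uniqueness and distribution function of the measure -/

/-- An exponentially finite measure is determined by its Fourier-Laplace transform on one line. -/
theorem measure_eq_of_fourierLaplace_eq {μ ν : Measure ℝ} {y : ℝ}
    (hμ : ∫⁻ t, ENNReal.ofReal (Real.exp (-y * t)) ∂μ < ⊤)
    (hν : ∫⁻ t, ENNReal.ofReal (Real.exp (-y * t)) ∂ν < ⊤)
    (h : ∀ z : ℂ, z.re = y →
      fourierLaplace μ (Complex.I * z) = fourierLaplace ν (Complex.I * z)) : μ = ν := by
  set w : ℝ → ENNReal := fun t => ENNReal.ofReal (Real.exp (-y * t)) with hw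
  have hwm : Measurable w := by fun_prop
  have hinv : ∀ ρ : Measure ℝ, (ρ.withDensity w).withDensity (fun t => (w t)⁻¹) = ρ := fun ρ =>
    withDensity_inv_same hwm
      (.of_forall fun t => by simp [hw, Real.exp_pos]) (.of_forall fun t => by simp [hw])
  -- The transform on the line `Re z = y` is the characteristic function of the weighted measure; by
  -- `hinv` the weight can be undone.
  have hchar : ∀ (ρ : Measure ℝ) (s : ℝ), charFun (ρ.withDensity w) s =
      fourierLaplace ρ (Complex.I * (y - s * Complex.I)) := by
    intro ρ s
    rw [charFun_apply_real, integral_withDensity_eq_integral_toReal_smul hwm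
      (.of_forall fun t => by simp [hw]), fourierLaplace]
    refine integral_congr_ae (.of_forall fun t => ?_)
    simp only [hw, I_mul_I_mul]
    rw [ENNReal.toReal_ofReal (Real.exp_pos _).le, Complex.real_smul, Complex.ofReal_exp,
      ← Complex.exp_add]
    congr 1
    push_cast; ring
  have : IsFiniteMeasure (μ.withDensity w) := isFiniteMeasure_withDensity hμ.ne
  have : IsFiniteMeasure (ν.withDensity w) := isFiniteMeasure_withDensity hν.ne
  rw [← hinv μ, ← hinv ν, Measure.ext_of_charFun (μ := μ.withDensity w) (ν := ν.withDensity w)]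
  ext s
  rw [hchar, hchar, h _ (by simp)]

/-- Only the finitely many `n` with `n + 1 ≤ exp t` contribute. -/
theorem summable_unitStep (t : ℝ) :
    Summable fun n : ℕ => unitStep (t - Real.log ((n : ℝ) + 1)) := by
  refine summable_of_hasFiniteSupport ((Set.finite_lt_nat ⌈Real.exp t⌉₊).subset fun n hn => ?_)
  have hn' : unitStep (t - Real.log ((n : ℝ) + 1)) ≠ 0 := hn
  have h : Real.log ((n : ℝ) + 1) ≤ t := by
    by_contra! hlt
    exact hn' (if_pos (by linarith))
  have h1 : (n : ℝ) + 1 ≤ Real.exp t := (Real.log_le_iff_le_exp (by positivity)).mp h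
  have h2 : (n : ℝ) < ⌈Real.exp t⌉₊ := by linarith [Nat.le_ceil (Real.exp t)]
  exact_mod_cast h2

theorem logIntegerMeasure_Ioc {a b : ℝ} (hab : a ≤ b) :
    logIntegerMeasure (Ioc a b) = ENNReal.ofReal (logIntegerCount b - logIntegerCount a) := by
  have hterm : ∀ c : ℝ, unitStep (b - c) - unitStep (a - c) = (Ioc a b).indicator 1 c := by
    intro c
    simp only [unitStep, indicator, mem_Ioc, Pi.one_apply]
    split_ifs <;> grind
  rw [logIntegerMeasure, Measure.sum_apply _ measurableSet_Ioc, logIntegerCount, logIntegerCount,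
    ← (summable_unitStep b).tsum_sub (summable_unitStep a), ENNReal.ofReal_tsum_of_nonneg]
  · refine tsum_congr fun n => ?_
    rw [hterm, Measure.dirac_apply' _ measurableSet_Ioc]
    simp only [indicator]
    split_ifs <;> simp
  · intro n
    rw [hterm]
    exact indicator_nonneg (fun _ _ => zero_le_one) _
  · exact (summable_unitStep b).sub (summable_unitStep a)

end

theorem mainTheorem9 :
    -- co-positive definiteness on the half-plane of convergence
    CoPositiveDefiniteOn riemannZeta {z : ℂ | 1 < z.re} ∧
    -- the representing measure, and its uniqueness
    (ExponentiallyFinite logIntegerMeasure (Ioi 1) ∧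
      (∀ z : ℂ, 1 < z.re →
        Integrable (fun t : ℝ => Complex.exp (Complex.I * (Complex.I * z) * t))
          logIntegerMeasure ∧
        riemannZeta z = fourierLaplace logIntegerMeasure (Complex.I * z)) ∧
      (∀ ν : Measure ℝ, ExponentiallyFinite ν (Ioi 1) →
        (∀ z : ℂ, 1 < z.re → riemannZeta z = fourierLaplace ν (Complex.I * z)) →
        ν = logIntegerMeasure)) ∧
    -- its distribution function
    ((∀ t : ℝ, Summable fun n : ℕ => unitStep (t - Real.log ((n : ℝ) + 1))) ∧
      (∀ a b : ℝ, a ≤ b → logIntegerMeasure (Ioc a b) =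
        ENNReal.ofReal (logIntegerCount b - logIntegerCount a))) ∧
    -- failure of both properties to the left of the pole
    (∀ T : Set ℂ, IsCosumSet T → IsOpen T → T.Nonempty → T ⊆ {z : ℂ | z.re < 1} →
      ¬ CoPositiveDefiniteOn riemannZeta T ∧ ¬ CoNegativeDefiniteOn riemannZeta T) := by
  refine ⟨coPositiveDefiniteOn_riemannZeta,
    ⟨exponentiallyFinite_logIntegerMeasure, fun z hz => ⟨?_, riemannZeta_eq_fourierLaplace hz⟩,
      fun ν hν h => ?_⟩,
    ⟨summable_unitStep, fun a b hab => logIntegerMeasure_Ioc hab⟩,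
    fun T hT hopen hne hsub => ?_⟩
  · simp_rw [I_mul_I_mul]
    exact integrable_exp_logIntegerMeasure hz
  · have h2 : (2 : ℝ) ∈ Ioi (1 : ℝ) := by simp
    refine measure_eq_of_fourierLaplace_eq (hν 2 h2) (exponentiallyFinite_logIntegerMeasure 2 h2)
      fun z hz => ?_
    have hz1 : 1 < z.re := by rw [hz]; norm_num
    rw [← h z hz1, riemannZeta_eq_fourierLaplace hz1]
  · have hdiff : DifferentiableOn ℂ riemannZeta {z : ℂ | z.re < 1} := fun z hz =>
      (differentiableAt_riemannZeta fun h => by simp [h] at hz).differentiableWithinAt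
    -- The first trivial zero, index `0` in `-2 * (n + 1)`.
    have hzero : riemannZeta ((-2 : ℝ) : ℂ) = 0 := by
      simpa using riemannZeta_neg_two_mul_nat_add_one 0
    have hne0 : riemannZeta 0 ≠ 0 := by rw [riemannZeta_zero]; norm_num
    exact ⟨not_coPositiveDefiniteOn_of_isCosumSet hdiff (by norm_num) hzero
        ⟨0, by simp, hne0⟩ hT hopen hne hsub,
      not_coPositiveDefiniteOn_of_isCosumSet hdiff.neg (y := -2) (by norm_num) (by simpa using hzero)
        ⟨0, by simp, by simpa using hne0⟩ hT hopen hne hsub⟩
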